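/- Market for lemons. Let $\Theta\subseteq[0,1]$ be a Polish subspace, $\mu_0$ a Borel probability measure on $\Theta$ (the prior), and $v:\Theta\cup\{1\}\to\mathbb R$ a (weakly) increasing function with $v(\theta)>\theta$ for all $\theta\in\Theta$ and $E_{\mu_0}[v(\theta)]<1$. A seller owns a car that she values at $\theta$ and that two buyers both value at $v(\theta)$. The seller's ask $a_S$ and the buyers' bids $b_1,b_2$ are chosen simultaneously from $[0,v(1)]$. The seller's payoff is $\max\{b_1,b_2\}$ if $a_S\le\max\{b_1,b_2\}$ and $\theta$ otherwise; buyer $i$'s payoff is $v(\theta)-b_i$ if $b_i>b_{-i}$ and $b_i\ge a_S$, it is $\tfrac12[v(\theta)-b_i]$ if $b_i=b_{-i}$ and $b_i\ge a_S$, and it is $0$ otherwise. Let $M$ be a Polish space of messages. A test is a Borel probability measure $\lambda$ on $\Theta\times M$ with marginal $\lambda_\Theta=\mu_0$. In the game $\langle G,\lambda\rangle$ a pair $(\theta,m)$ is drawn from $\lambda$, the seller observes $(\theta,m)$, the buyers observe only $m$, and all move simultaneously. A strategy profile $\sigma$ consists of measurable maps $\alpha_S:\Theta\times M\to[0,v(1)]$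 and $\beta_1,\beta_2:M\to[0,v(1)]$, and the players' payoffs from $(\lambda,\sigma)$ are their expected payoffs under $\lambda$. The profile $(\lambda,\sigma)$ is WD-IC if $\sigma$ is a Bayesian Nash equilibrium of $\langle G,\lambda\rangle$ (no player gains in expectation by switching to another strategy of hers) and $\alpha_S(\theta,m)=\theta$ for all $(\theta,m)$. It is credible if, with $\sigma$ held fixed, $\lambda$ maximizes the seller's expected payoff among all tests $\lambda'$ with the same message distribution, $\lambda'_M=\lambda_M$. Fix $m_0\in M$, let $\lambda_0=\mu_0\times\delta_{m_0}$ be the null information structure, and let $R_0$ be the supremum of the seller's payoffs over all $\sigma$ for which $(\lambda_0,\sigma)$ is WD-IC. Then this set of payoffs is nonempty and bounded above, so that $R_0$ is a well-defined real number, and under every credible and WD-IC profile $(\lambda,\sigma)$ the seller's payoff is at most $R_0$. -/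

import Mathlib

open MeasureTheory

noncomputable section

namespace Lemons

/-- The set `[0, v(1)]` of feasible ask prices and of feasible bids. -/
abbrev Price (v : ℝ → ℝ) : Type := Set.Icc (0 : ℝ) (v 1)

/-- The seller's payoff when the car has quality `θ`, she asks `a` and the bids are `b₁`, `b₂`. -/
def sellerPayoff (θ a b₁ b₂ : ℝ) : ℝ :=
  if a ≤ max b₁ b₂ then max b₁ b₂ else θ

/-- The payoff of a buyer who bids `b` when the other buyer bids `b'`, the seller asks `a` and the
car has quality `θ`. -/
def buyerPayoff (v : ℝ → ℝ) (θ a b b' : ℝ) : ℝ :=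
  if b' < b ∧ a ≤ b then v θ - b
  else if b = b' ∧ a ≤ b then (1 / 2) * (v θ - b)
  else 0

/-- A seller's strategy: the seller observes the quality and the public message. -/
abbrev SellerStrategy (Θ : Set ℝ) (v : ℝ → ℝ) (M : Type*) [MeasurableSpace M] : Type _ :=
  {α : Θ × M → Price v // Measurable α}

/-- A buyer's strategy: a buyer observes only the public message. -/
abbrev BuyerStrategy (v : ℝ → ℝ) (M : Type*) [MeasurableSpace M] : Type _ :=
  {β : M → Price v // Measurable β}

/-- A (pure) strategy profile: the seller's ask and the two buyers' bids. -/
structure StrategyProfile (Θ : Set ℝ) (v : ℝ → ℝ) (M : Type*) [MeasurableSpace M] where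
  ask : SellerStrategy Θ v M
  bid₁ : BuyerStrategy v M
  bid₂ : BuyerStrategy v M

section Game

variable {Θ : Set ℝ} {v : ℝ → ℝ} {M : Type*} [MeasurableSpace M]

/-- A test: a joint distribution of qualities and messages whose marginal on qualities is the
prior. -/
def IsTest (μ₀ : Measure Θ) (lam : Measure (Θ × M)) : Prop :=
  IsProbabilityMeasure lam ∧ lam.fst = μ₀

/-- The seller's expected payoff under the test `lam`. -/
def sellerValue (lam : Measure (Θ × M)) (α : SellerStrategy Θ v M)
    (β₁ β₂ : BuyerStrategy v M) : ℝ :=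
  ∫ x : Θ × M, sellerPayoff (x.1 : ℝ) (α.1 x : ℝ) (β₁.1 x.2 : ℝ) (β₂.1 x.2 : ℝ) ∂lam

/-- The expected payoff, under the test `lam`, of a buyer who plays `β` against the ask `α` and the
other buyer's strategy `β'`. -/
def buyerValue (lam : Measure (Θ × M)) (α : SellerStrategy Θ v M)
    (β β' : BuyerStrategy v M) : ℝ :=
  ∫ x : Θ × M, buyerPayoff v (x.1 : ℝ) (α.1 x : ℝ) (β.1 x.2 : ℝ) (β'.1 x.2 : ℝ) ∂lam

/-- The seller's expected payoff under the profile `(lam, σ)`. -/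
def sellerProfit (lam : Measure (Θ × M)) (σ : StrategyProfile Θ v M) : ℝ :=
  sellerValue lam σ.ask σ.bid₁ σ.bid₂

/-- Bayesian Nash equilibrium of the game in which `(θ, m)` is drawn from `lam`, the seller sees
`(θ, m)`, the buyers see `m`, and all three move simultaneously. -/
def IsBayesNash (lam : Measure (Θ × M)) (σ : StrategyProfile Θ v M) : Prop :=
  (∀ α : SellerStrategy Θ v M,
    sellerValue lam α σ.bid₁ σ.bid₂ ≤ sellerValue lam σ.ask σ.bid₁ σ.bid₂) ∧
  (∀ β : BuyerStrategy v M,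
    buyerValue lam σ.ask β σ.bid₂ ≤ buyerValue lam σ.ask σ.bid₁ σ.bid₂) ∧
  (∀ β : BuyerStrategy v M,
    buyerValue lam σ.ask β σ.bid₁ ≤ buyerValue lam σ.ask σ.bid₂ σ.bid₁)

/-- WD-IC: a Bayesian Nash equilibrium in which the seller asks her reservation value. -/
def IsWDIC (lam : Measure (Θ × M)) (σ : StrategyProfile Θ v M) : Prop :=
  IsBayesNash lam σ ∧ ∀ (θ : Θ) (m : M), (σ.ask.1 (θ, m) : ℝ) = θ

/-- The tests that induce the same distribution of messages as `lam`. -/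
def undetectable (μ₀ : Measure Θ) (lam : Measure (Θ × M)) : Set (Measure (Θ × M)) :=
  {lam' | IsTest μ₀ lam' ∧ lam'.snd = lam.snd}

/-- Credibility: holding the strategies fixed, `lam` maximizes the seller's payoff among the tests
with the same message distribution. -/
def IsCredible (μ₀ : Measure Θ) (lam : Measure (Θ × M)) (σ : StrategyProfile Θ v M) : Prop :=
  lam ∈ undetectable μ₀ lam ∧
    ∀ lam' ∈ undetectable μ₀ lam, sellerProfit lam' σ ≤ sellerProfit lam σ

/-- The null information structure, which always sends the message `m₀`. -/
def nullTest (μ₀ : Measure Θ) (m₀ : M) : Measure (Θ × M) :=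
  μ₀.prod (Measure.dirac m₀)

/-- The seller's payoffs in the WD-IC profiles of the null information structure. -/
def noInfoPayoffs (v : ℝ → ℝ) (μ₀ : Measure Θ) (m₀ : M) : Set ℝ :=
  {r | ∃ σ : StrategyProfile Θ v M,
    IsWDIC (nullTest μ₀ m₀) σ ∧ sellerProfit (nullTest μ₀ m₀) σ = r}

/-- The supremum of the seller's payoffs in WD-IC profiles when no information is disclosed. -/
def R₀ (v : ℝ → ℝ) (μ₀ : Measure Θ) (m₀ : M) : ℝ :=
  sSup (noInfoPayoffs v μ₀ m₀)

end Game

end Lemons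

end

open Filter Topology

namespace Lemons

/-! With a truthful ask and top bid `b`, the car is sold exactly when `θ ≤ b`, so the seller gets
`max θ b` and the buyers jointly get `tradeSurplus v θ b`. Their sum is `θ`, plus `v θ - θ` if there
is trade: the price cancels, and more trade means more welfare.

Let `p` be the largest price at which uninformed buyers do not lose. They break even there
(`exists_greatest_price`), and bidding `p` is an equilibrium without information
(`exists_isWDIC_nullTest`), in which every car with `θ ≤ p` is sold and the seller takes all the
welfare. If a credible WD-IC profile trades only cars with `θ ≤ p`, its welfare is no larger; since
its buyers do not lose, the seller's payoff is no larger either (`sellerProfit_le_integral_max`).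

That only such cars are traded is `ae_le_of_isCredible`. If `c` is the essential supremum of traded
qualities and `t < c`, some traded cars are better than `t`. Were there also cars of quality at most
`t` facing bids at most `t`, swapping messages between the two groups would keep both marginals and
raise the seller's payoff (`measure_eq_zero_of_isCredible`). Hence almost every car facing a bid
below `c` has quality at least `c`. Buyers do not lose on the messages with bid at least `c`, where
lowering the price to `c` only helps them, and the remaining cars contribute nonnegatively at price
`c`. So uninformed buyers would not lose at `c`, giving `c ≤ p`. -/

/-- The surplus over the price `b` of a car of quality `θ` if it is sold at that price, which
happens when `θ ≤ b`. -/
noncomputable def tradeSurplus (v : ℝ → ℝ) (θ b : ℝ) : ℝ :=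
  if θ ≤ b then v θ - b else 0

/-! ### Pointwise payoffs under a truthful ask -/

theorem sellerPayoff_self (θ b₁ b₂ : ℝ) : sellerPayoff θ θ b₁ b₂ = max θ (max b₁ b₂) := by
  unfold sellerPayoff
  split_ifs with h
  · rw [max_eq_right h]
  · rw [max_eq_left (not_le.1 h).le]

theorem sellerPayoff_le (θ a b₁ b₂ : ℝ) : sellerPayoff θ a b₁ b₂ ≤ max θ (max b₁ b₂) := by
  unfold sellerPayoff
  split_ifs with h
  · exact le_max_right _ _
  · exact le_max_left _ _

/-- In a tie each buyer gets half of the surplus; otherwise the lower bidder gets nothing. Either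
way the sum depends on the bids only through their maximum. -/
theorem buyerPayoff_add (v : ℝ → ℝ) (θ b₁ b₂ : ℝ) :
    buyerPayoff v θ θ b₁ b₂ + buyerPayoff v θ θ b₂ b₁ = tradeSurplus v θ (max b₁ b₂) := by
  unfold buyerPayoff tradeSurplus
  rcases lt_trichotomy b₁ b₂ with h | rfl | h
  · simp [h, h.not_gt, h.ne, h.ne', max_eq_right h.le]
  · by_cases h : θ ≤ b₁ <;> simp [h]
    ring
  · simp [h, h.not_gt, h.ne, h.ne', max_eq_left h.le]

theorem max_eq_add_ite (θ b : ℝ) : max θ b = θ + if θ ≤ b then b - θ else 0 := by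
  split_ifs with h
  · rw [max_eq_right h]; ring
  · rw [max_eq_left (not_le.1 h).le]; ring

section

variable {Θ : Set ℝ} {v : ℝ → ℝ} {M : Type*} [MeasurableSpace M]

/-! ### Measurability and integrability of payoffs -/

theorem value_mem_Icc (hΘ : Θ ⊆ Set.Icc (0 : ℝ) 1) (hv : MonotoneOn v (insert (1 : ℝ) Θ))
    (hgain : ∀ θ ∈ Θ, θ < v θ) (θ : Θ) : 0 ≤ v θ ∧ v θ ≤ v 1 :=
  ⟨(hΘ θ.2).1.trans (hgain θ θ.2).le,
    hv (Set.mem_insert_of_mem _ θ.2) (Set.mem_insert _ _) (hΘ θ.2).2⟩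

theorem measurable_value (hv : MonotoneOn v (insert (1 : ℝ) Θ)) :
    Measurable fun θ : Θ => v θ :=
  Monotone.measurable fun x y h =>
    hv (Set.mem_insert_of_mem _ x.2) (Set.mem_insert_of_mem _ y.2) h

theorem measurable_tradeSurplus {α : Type*} [MeasurableSpace α]
    (hvm : Measurable fun θ : Θ => v θ) {f : α → Θ} {g : α → ℝ} (hf : Measurable f)
    (hg : Measurable g) : Measurable fun x => tradeSurplus v (f x) (g x) := by
  unfold tradeSurplus
  exact Measurable.ite (measurableSet_le hf.subtype_val hg) ((hvm.comp hf).sub hg)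
    measurable_const

theorem integrable_tradeSurplus {α : Type*} [MeasurableSpace α] {μ : Measure α}
    [IsFiniteMeasure μ] (hΘ : Θ ⊆ Set.Icc (0 : ℝ) 1)
    (hv : MonotoneOn v (insert (1 : ℝ) Θ)) (hgain : ∀ θ ∈ Θ, θ < v θ)
    {f : α → Θ} {g : α → ℝ} (hf : Measurable f)
    (hg : Measurable g) (hg' : ∀ x, g x ∈ Set.Icc 0 (v 1)) :
    Integrable (fun x => tradeSurplus v (f x) (g x)) μ := by
  refine Integrable.of_bound
    (measurable_tradeSurplus (measurable_value hv) hf hg).aestronglyMeasurable (v 1)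
    (ae_of_all _ fun x => ?_)
  have h := value_mem_Icc hΘ hv hgain (f x)
  have h' := hg' x
  rw [Real.norm_eq_abs, abs_le]
  unfold tradeSurplus
  split_ifs <;> constructor <;> linarith [h.1, h.2, h'.1, h'.2]

theorem measurable_buyerPayoff (hv : MonotoneOn v (insert (1 : ℝ) Θ))
    (α : SellerStrategy Θ v M) (β β' : BuyerStrategy v M) :
    Measurable (fun x : Θ × M =>
      buyerPayoff v (x.1 : ℝ) (α.1 x : ℝ) (β.1 x.2 : ℝ) (β'.1 x.2 : ℝ)) := by
  have hα : Measurable fun x : Θ × M => (α.1 x : ℝ) := α.2.subtype_val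
  have hβ : Measurable fun x : Θ × M => (β.1 x.2 : ℝ) := (β.2.comp measurable_snd).subtype_val
  have hβ' : Measurable fun x : Θ × M => (β'.1 x.2 : ℝ) :=
    (β'.2.comp measurable_snd).subtype_val
  have hv' : Measurable fun x : Θ × M => v x.1 := (measurable_value hv).comp measurable_fst
  unfold buyerPayoff
  exact Measurable.ite ((measurableSet_lt hβ' hβ).inter (measurableSet_le hα hβ))
    (hv'.sub hβ)
    (Measurable.ite ((measurableSet_eq_fun hβ hβ').inter (measurableSet_le hα hβ))
      ((hv'.sub hβ).const_mul _) measurable_const)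

theorem integrable_buyerPayoff {lam : Measure (Θ × M)} [IsFiniteMeasure lam]
    (hΘ : Θ ⊆ Set.Icc (0 : ℝ) 1)
    (hv : MonotoneOn v (insert (1 : ℝ) Θ)) (hgain : ∀ θ ∈ Θ, θ < v θ)
    (α : SellerStrategy Θ v M) (β β' : BuyerStrategy v M) :
    Integrable (fun x : Θ × M =>
      buyerPayoff v (x.1 : ℝ) (α.1 x : ℝ) (β.1 x.2 : ℝ) (β'.1 x.2 : ℝ)) lam := by
  refine Integrable.of_bound (measurable_buyerPayoff hv α β β').aestronglyMeasurable (v 1)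
    (ae_of_all _ fun x => ?_)
  have h := value_mem_Icc hΘ hv hgain x.1
  have h' := (β.1 x.2).2
  rw [Real.norm_eq_abs, abs_le]
  unfold buyerPayoff
  split_ifs <;> constructor <;> linarith [h.1, h.2, h'.1, h'.2]

theorem integrable_max {α : Type*} [MeasurableSpace α] {μ : Measure α}
    [IsFiniteMeasure μ] (hΘ : Θ ⊆ Set.Icc (0 : ℝ) 1) {C : ℝ}
    {f : α → Θ} {g : α → ℝ} (hf : Measurable f)
    (hg : Measurable g) (hg' : ∀ x, g x ∈ Set.Icc 0 C) :
    Integrable (fun x => max (f x : ℝ) (g x)) μ := by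
  refine Integrable.of_bound (hf.subtype_val.max hg).aestronglyMeasurable (max 1 C)
    (ae_of_all _ fun x => ?_)
  rw [Real.norm_eq_abs, abs_of_nonneg ((hΘ (f x).2).1.trans (le_max_left _ _))]
  exact max_le_max (hΘ (f x).2).2 (hg' x).2

theorem integrable_sellerPayoff {lam : Measure (Θ × M)} [IsFiniteMeasure lam]
    (hΘ : Θ ⊆ Set.Icc (0 : ℝ) 1) (α : SellerStrategy Θ v M) (β β' : BuyerStrategy v M) :
    Integrable (fun x : Θ × M =>
      sellerPayoff (x.1 : ℝ) (α.1 x : ℝ) (β.1 x.2 : ℝ) (β'.1 x.2 : ℝ)) lam := by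
  have hα : Measurable fun x : Θ × M => (α.1 x : ℝ) := α.2.subtype_val
  have hβ : Measurable fun x : Θ × M => (β.1 x.2 : ℝ) := (β.2.comp measurable_snd).subtype_val
  have hβ' : Measurable fun x : Θ × M => (β'.1 x.2 : ℝ) :=
    (β'.2.comp measurable_snd).subtype_val
  refine Integrable.of_bound (Measurable.aestronglyMeasurable ?_) (max 1 (v 1))
    (ae_of_all _ fun x => ?_)
  · unfold sellerPayoff
    exact Measurable.ite (measurableSet_le hα (hβ.max hβ')) (hβ.max hβ')
      measurable_fst.subtype_val
  · have h := hΘ x.1.2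
    have h₁ := (β.1 x.2).2
    have h₂ := (β'.1 x.2).2
    rw [Real.norm_eq_abs, abs_of_nonneg]
    · exact (sellerPayoff_le _ _ _ _).trans (max_le_max h.2 (max_le h₁.2 h₂.2))
    · unfold sellerPayoff
      split_ifs
      · exact h₁.1.trans (le_max_left _ _)
      · exact h.1

/-! ### Prices and buyers' surplus in a WD-IC profile -/

/-- The price at which the car is offered to be bought after each message. -/
def topBid (σ : StrategyProfile Θ v M) (m : M) : ℝ :=
  max (σ.bid₁.1 m : ℝ) (σ.bid₂.1 m)

theorem measurable_topBid (σ : StrategyProfile Θ v M) : Measurable (topBid σ) :=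
  σ.bid₁.2.subtype_val.max σ.bid₂.2.subtype_val

theorem topBid_mem_Icc (σ : StrategyProfile Θ v M) (m : M) : topBid σ m ∈ Set.Icc 0 (v 1) :=
  ⟨(σ.bid₁.1 m).2.1.trans (le_max_left _ _), max_le (σ.bid₁.1 m).2.2 (σ.bid₂.1 m).2.2⟩

theorem sellerProfit_eq {lam : Measure (Θ × M)} {σ : StrategyProfile Θ v M}
    (hask : ∀ (θ : Θ) (m : M), (σ.ask.1 (θ, m) : ℝ) = θ) :
    sellerProfit lam σ = ∫ x : Θ × M, max (x.1 : ℝ) (topBid σ x.2) ∂lam := by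
  unfold sellerProfit sellerValue
  congr 1 with x
  rw [hask x.1 x.2, sellerPayoff_self, topBid]

/-- A buyer cannot lose by bidding zero after the messages in `A`. -/
theorem setIntegral_buyerPayoff_nonneg {lam : Measure (Θ × M)} [IsFiniteMeasure lam]
    (hΘ : Θ ⊆ Set.Icc (0 : ℝ) 1)
    (hv : MonotoneOn v (insert (1 : ℝ) Θ)) (hgain : ∀ θ ∈ Θ, θ < v θ) (hv1 : 0 ≤ v 1)
    {α : SellerStrategy Θ v M} {β β' : BuyerStrategy v M}
    (hbest : ∀ γ : BuyerStrategy v M, buyerValue lam α γ β' ≤ buyerValue lam α β β')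
    {A : Set M} (hA : MeasurableSet A) :
    0 ≤ ∫ x in Prod.snd ⁻¹' A,
      buyerPayoff v (x.1 : ℝ) (α.1 x : ℝ) (β.1 x.2 : ℝ) (β'.1 x.2 : ℝ) ∂lam := by
  classical
  have hA' : MeasurableSet (Prod.snd ⁻¹' A : Set (Θ × M)) := measurable_snd hA
  let γ : BuyerStrategy v M :=
    ⟨A.piecewise (fun _ => ⟨0, le_rfl, hv1⟩) β.1, Measurable.piecewise hA measurable_const β.2⟩
  have hγ : ∀ m, γ.1 m = if m ∈ A then ⟨0, le_rfl, hv1⟩ else β.1 m := fun _ => rfl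
  have hdev := hbest γ
  unfold buyerValue at hdev
  rw [← integral_add_compl hA' (integrable_buyerPayoff hΘ hv hgain α γ β'),
    ← integral_add_compl hA' (integrable_buyerPayoff hΘ hv hgain α β β')] at hdev
  have hcompl : ∫ x in (Prod.snd ⁻¹' A)ᶜ,
        buyerPayoff v (x.1 : ℝ) (α.1 x : ℝ) (γ.1 x.2 : ℝ) (β'.1 x.2 : ℝ) ∂lam =
      ∫ x in (Prod.snd ⁻¹' A)ᶜ,
        buyerPayoff v (x.1 : ℝ) (α.1 x : ℝ) (β.1 x.2 : ℝ) (β'.1 x.2 : ℝ) ∂lam := by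
    refine setIntegral_congr_fun hA'.compl fun x hx => ?_
    have : γ.1 x.2 = β.1 x.2 := (hγ x.2).trans (if_neg hx)
    simp only [this]
  have hzero : 0 ≤ ∫ x in Prod.snd ⁻¹' A,
      buyerPayoff v (x.1 : ℝ) (α.1 x : ℝ) (γ.1 x.2 : ℝ) (β'.1 x.2 : ℝ) ∂lam := by
    -- A buyer bidding zero either gets nothing or acquires all or half of a car worth `v θ ≥ 0` for
    -- free.
    refine setIntegral_nonneg hA' fun x hx => ?_
    have h0 : (γ.1 x.2 : ℝ) = 0 := by
      rw [show γ.1 x.2 = ⟨0, le_rfl, hv1⟩ from (hγ x.2).trans (if_pos hx)]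
    have := (value_mem_Icc hΘ hv hgain x.1).1
    rw [h0]
    unfold buyerPayoff
    split_ifs <;> linarith
  linarith

/-- In a WD-IC profile the buyers jointly do not lose after the messages in `A`. -/
theorem setIntegral_tradeSurplus_nonneg {lam : Measure (Θ × M)} [IsFiniteMeasure lam]
    (hΘ : Θ ⊆ Set.Icc (0 : ℝ) 1)
    (hv : MonotoneOn v (insert (1 : ℝ) Θ)) (hgain : ∀ θ ∈ Θ, θ < v θ) (hv1 : 0 ≤ v 1)
    {σ : StrategyProfile Θ v M} (hσ : IsWDIC lam σ) {A : Set M} (hA : MeasurableSet A) :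
    0 ≤ ∫ x in Prod.snd ⁻¹' A, tradeSurplus v (x.1 : ℝ) (topBid σ x.2) ∂lam := by
  have h₁ := setIntegral_buyerPayoff_nonneg hΘ hv hgain hv1 hσ.1.2.1 hA
  have h₂ := setIntegral_buyerPayoff_nonneg hΘ hv hgain hv1 hσ.1.2.2 hA
  have h := add_nonneg h₁ h₂
  rw [← integral_add (integrable_buyerPayoff hΘ hv hgain _ _ _).integrableOn
    (integrable_buyerPayoff hΘ hv hgain _ _ _).integrableOn] at h
  refine h.trans_eq (integral_congr_ae (ae_of_all _ fun x => ?_))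
  dsimp only
  rw [hσ.2 x.1 x.2, buyerPayoff_add, topBid]

/-! ### Exchanging mass between two sets -/

section Exchange

variable {X Y : Type*} [MeasurableSpace X] [MeasurableSpace Y]

/-- The measure obtained from `μ` by exchanging the second coordinates of independently drawn
points of `T` and of `S`. -/
noncomputable def exchange (μ : Measure (X × Y)) (T S : Set (X × Y)) : Measure (X × Y) :=
  μ.restrict (T ∪ S)ᶜ + (1 - μ S) • μ.restrict T + (1 - μ T) • μ.restrict S +
    ((μ.restrict T).prod (μ.restrict S)).map (fun p => (p.1.1, p.2.2)) +
    ((μ.restrict T).prod (μ.restrict S)).map (fun p => (p.2.1, p.1.2))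

variable {μ : Measure (X × Y)} {T S : Set (X × Y)}

theorem restrict_add_restrict_add_restrict (hT : MeasurableSet T) (hS : MeasurableSet S)
    (hd : Disjoint T S) :
    μ.restrict (T ∪ S)ᶜ + μ.restrict T + μ.restrict S = μ := by
  rw [add_assoc, ← Measure.restrict_union hd hS, Measure.restrict_compl_add_restrict (hT.union hS)]

theorem one_sub_smul_add_smul {α : Type*} [MeasurableSpace α] (ν : Measure α) {a : ENNReal}
    (ha : a ≤ 1) : (1 - a) • ν + a • ν = ν := by
  rw [← add_smul, tsub_add_cancel_of_le ha, one_smul]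

variable [IsProbabilityMeasure μ]

/-- The cross term keeping first coordinates from `T` has first marginal that of `μ S • μ.restrict
T`, exactly what the weight `1 - μ S` removed; symmetrically for `S`. Hence neither restriction
needs to be normalised. -/
theorem exchange_fst (hT : MeasurableSet T) (hS : MeasurableSet S) (hd : Disjoint T S) :
    (exchange μ T S).fst = μ.fst := by
  have e₁ : (((μ.restrict T).prod (μ.restrict S)).map
      (fun p => (p.1.1, p.2.2))).fst = (μ S • μ.restrict T).fst := by
    unfold Measure.fst
    rw [Measure.map_map measurable_fst (by fun_prop), ← Measure.restrict_apply_univ S,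
      ← Measure.map_fst_prod, Measure.map_map measurable_fst measurable_fst]
    rfl
  have e₂ : (((μ.restrict T).prod (μ.restrict S)).map
      (fun p => (p.2.1, p.1.2))).fst = (μ T • μ.restrict S).fst := by
    unfold Measure.fst
    rw [Measure.map_map measurable_fst (by fun_prop), ← Measure.restrict_apply_univ T,
      ← Measure.map_snd_prod, Measure.map_map measurable_fst measurable_snd]
    rfl
  unfold exchange
  rw [Measure.fst_add, Measure.fst_add, e₁, e₂, ← Measure.fst_add, ← Measure.fst_add]
  congr 1
  calc _ = μ.restrict (T ∪ S)ᶜ + ((1 - μ S) • μ.restrict T + μ S • μ.restrict T) +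
        ((1 - μ T) • μ.restrict S + μ T • μ.restrict S) := by abel
    _ = μ := by
      rw [one_sub_smul_add_smul _ prob_le_one, one_sub_smul_add_smul _ prob_le_one,
        restrict_add_restrict_add_restrict hT hS hd]

theorem exchange_snd (hT : MeasurableSet T) (hS : MeasurableSet S) (hd : Disjoint T S) :
    (exchange μ T S).snd = μ.snd := by
  have e₁ : (((μ.restrict T).prod (μ.restrict S)).map
      (fun p => (p.1.1, p.2.2))).snd = (μ T • μ.restrict S).snd := by
    unfold Measure.snd
    rw [Measure.map_map measurable_snd (by fun_prop), ← Measure.restrict_apply_univ T,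
      ← Measure.map_snd_prod, Measure.map_map measurable_snd measurable_snd]
    rfl
  have e₂ : (((μ.restrict T).prod (μ.restrict S)).map
      (fun p => (p.2.1, p.1.2))).snd = (μ S • μ.restrict T).snd := by
    unfold Measure.snd
    rw [Measure.map_map measurable_snd (by fun_prop), ← Measure.restrict_apply_univ S,
      ← Measure.map_fst_prod, Measure.map_map measurable_snd measurable_fst]
    rfl
  unfold exchange
  rw [Measure.snd_add, Measure.snd_add, e₁, e₂, ← Measure.snd_add, ← Measure.snd_add]
  congr 1
  calc _ = μ.restrict (T ∪ S)ᶜ + ((1 - μ S) • μ.restrict T + μ S • μ.restrict T) +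
        ((1 - μ T) • μ.restrict S + μ T • μ.restrict S) := by abel
    _ = μ := by
      rw [one_sub_smul_add_smul _ prob_le_one, one_sub_smul_add_smul _ prob_le_one,
        restrict_add_restrict_add_restrict hT hS hd]

/-- Writing the change as one integral over pairs in `T × S` makes its sign a pointwise matter. -/
theorem integral_exchange (hT : MeasurableSet T) (hS : MeasurableSet S) (hd : Disjoint T S)
    {f : X × Y → ℝ} (hf : Measurable f) {C : ℝ} (hC : ∀ x, |f x| ≤ C) :
    ∫ x, f x ∂(exchange μ T S) = ∫ x, f x ∂μ +
      ∫ p, (f (p.1.1, p.2.2) + f (p.2.1, p.1.2) - f p.1 - f p.2)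
        ∂((μ.restrict T).prod (μ.restrict S)) := by
  have hi : ∀ (ν : Measure (X × Y)) [IsFiniteMeasure ν], Integrable f ν := fun ν _ =>
    Integrable.of_bound hf.aestronglyMeasurable C (ae_of_all _ hC)
  have hiP : ∀ {g : (X × Y) × (X × Y) → X × Y}, Measurable g →
      Integrable (fun p => f (g p)) ((μ.restrict T).prod (μ.restrict S)) := fun hg =>
    Integrable.of_bound (hf.comp hg).aestronglyMeasurable C (ae_of_all _ fun p => hC _)
  have : IsFiniteMeasure ((1 - μ S) • μ.restrict T) :=
    Measure.smul_finite _ (ENNReal.sub_ne_top ENNReal.one_ne_top)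
  have : IsFiniteMeasure ((1 - μ T) • μ.restrict S) :=
    Measure.smul_finite _ (ENNReal.sub_ne_top ENNReal.one_ne_top)
  have h0 : ∫ x, f x ∂μ =
      ∫ x in (T ∪ S)ᶜ, f x ∂μ + ∫ x in T, f x ∂μ + ∫ x in S, f x ∂μ := by
    rw [← integral_add_measure (hi _) (hi _), ← integral_add_measure (hi _) (hi _),
      restrict_add_restrict_add_restrict hT hS hd]
  have hm₁ : Measurable fun p : (X × Y) × (X × Y) => (p.1.1, p.2.2) := by fun_prop
  have hm₂ : Measurable fun p : (X × Y) × (X × Y) => (p.2.1, p.1.2) := by fun_prop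
  have hP : ∫ p, (f (p.1.1, p.2.2) + f (p.2.1, p.1.2) - f p.1 - f p.2)
        ∂((μ.restrict T).prod (μ.restrict S)) =
      ∫ p, f (p.1.1, p.2.2) ∂((μ.restrict T).prod (μ.restrict S)) +
      ∫ p, f (p.2.1, p.1.2) ∂((μ.restrict T).prod (μ.restrict S)) -
      ∫ p, f p.1 ∂((μ.restrict T).prod (μ.restrict S)) -
      ∫ p, f p.2 ∂((μ.restrict T).prod (μ.restrict S)) := by
    rw [← integral_add (hiP hm₁) (hiP hm₂)]
    refine (integral_sub (((hiP hm₁).add (hiP hm₂)).sub (hiP measurable_fst))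
      (hiP measurable_snd)).trans (congrArg (· - _) ?_)
    exact integral_sub ((hiP hm₁).add (hiP hm₂)) (hiP measurable_fst)
  unfold exchange
  rw [integral_add_measure (hi _) (hi _), integral_add_measure (hi _) (hi _),
    integral_add_measure (hi _) (hi _), integral_add_measure (hi _) (hi _),
    integral_smul_measure, integral_smul_measure,
    integral_map hm₁.aemeasurable hf.aestronglyMeasurable,
    integral_map hm₂.aemeasurable hf.aestronglyMeasurable,
    hP, integral_fun_fst f, integral_fun_snd f, h0,
    ENNReal.toReal_sub_of_le prob_le_one ENNReal.one_ne_top,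
    ENNReal.toReal_sub_of_le prob_le_one ENNReal.one_ne_top]
  simp only [measureReal_def, Measure.restrict_apply_univ, smul_eq_mul, ENNReal.toReal_one]
  ring

end Exchange

/-! ### Credibility rules out profitable swaps -/

/-- Under a credible test it cannot be that both cars better than `t` are traded, and cars no better
than `t` face prices of at most `t`. -/
theorem measure_eq_zero_of_isCredible {μ₀ : Measure Θ} {lam : Measure (Θ × M)}
    (hΘ : Θ ⊆ Set.Icc (0 : ℝ) 1) {σ : StrategyProfile Θ v M}
    (hlam : IsTest μ₀ lam) (hcred : IsCredible μ₀ lam σ)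
    (hask : ∀ (θ : Θ) (m : M), (σ.ask.1 (θ, m) : ℝ) = θ) {t : ℝ}
    (ht : lam {x | t < (x.1 : ℝ) ∧ (x.1 : ℝ) ≤ topBid σ x.2} ≠ 0) :
    lam {x | (x.1 : ℝ) ≤ t ∧ topBid σ x.2 ≤ t} = 0 := by
  have := hlam.1
  set T : Set (Θ × M) := {x | t < (x.1 : ℝ) ∧ (x.1 : ℝ) ≤ topBid σ x.2} with hTdef
  set S : Set (Θ × M) := {x | (x.1 : ℝ) ≤ t ∧ topBid σ x.2 ≤ t} with hSdef
  have hb : Measurable fun x : Θ × M => topBid σ x.2 := (measurable_topBid σ).comp measurable_snd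
  have hθ : Measurable fun x : Θ × M => (x.1 : ℝ) := measurable_fst.subtype_val
  have hT : MeasurableSet T :=
    (measurableSet_lt measurable_const hθ).inter (measurableSet_le hθ hb)
  have hS : MeasurableSet S :=
    (measurableSet_le hθ measurable_const).inter (measurableSet_le hb measurable_const)
  have hd : Disjoint T S :=
    Set.disjoint_left.2 fun x hx hx' => absurd hx.1 (not_lt.2 hx'.1)
  by_contra hne
  have htest : exchange lam T S ∈ undetectable μ₀ lam := by
    refine ⟨⟨⟨?_⟩, (exchange_fst hT hS hd).trans hlam.2⟩, exchange_snd hT hS hd⟩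
    rw [← Measure.fst_univ, exchange_fst hT hS hd, Measure.fst_univ, measure_univ]
  have hle := hcred.2 _ htest
  have hbd : ∀ x : Θ × M, |max (x.1 : ℝ) (topBid σ x.2)| ≤ max 1 (v 1) := fun x => by
    rw [abs_of_nonneg ((hΘ x.1.2).1.trans (le_max_left _ _))]
    exact max_le_max (hΘ x.1.2).2 (topBid_mem_Icc σ x.2).2
  rw [sellerProfit_eq hask, sellerProfit_eq hask,
    integral_exchange (f := fun x : Θ × M => max (x.1 : ℝ) (topBid σ x.2)) hT hS hd
      (hθ.max hb) hbd] at hle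
  have hpos : ∀ p ∈ T ×ˢ S, 0 < max (p.1.1 : ℝ) (topBid σ p.2.2) +
      max (p.2.1 : ℝ) (topBid σ p.1.2) - max (p.1.1 : ℝ) (topBid σ p.1.2) -
      max (p.2.1 : ℝ) (topBid σ p.2.2) := by
    -- The gain from swapping a pair is the quality of the car from `T` minus the larger of the
    -- quality and the bid from `S`: above `t` against at most `t`.
    rintro p ⟨⟨h₁, h₂⟩, h₃, h₄⟩
    rw [max_eq_left (h₄.trans h₁.le), max_eq_right (h₃.trans (h₁.le.trans h₂)), max_eq_right h₂]
    linarith [max_le h₃ h₄]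
  have hint : 0 < ∫ p, (max (p.1.1 : ℝ) (topBid σ p.2.2) +
      max (p.2.1 : ℝ) (topBid σ p.1.2) - max (p.1.1 : ℝ) (topBid σ p.1.2) -
      max (p.2.1 : ℝ) (topBid σ p.2.2)) ∂((lam.restrict T).prod (lam.restrict S)) := by
    rw [Measure.prod_restrict]
    have hi : ∀ {f : (Θ × M) × (Θ × M) → Θ} {g : (Θ × M) × (Θ × M) → M}, Measurable f →
        Measurable g → Integrable (fun p => max (f p : ℝ) (topBid σ (g p)))
          ((lam.prod lam).restrict (T ×ˢ S)) := fun hf hg =>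
      integrable_max hΘ hf ((measurable_topBid σ).comp hg) fun p => topBid_mem_Icc σ _
    rw [setIntegral_pos_iff_support_of_nonneg_ae]
    · refine lt_of_lt_of_le (pos_iff_ne_zero.2 (mul_ne_zero ht hne) : 0 < lam T * lam S) ?_
      rw [← Measure.prod_prod]
      exact measure_mono fun p hp => ⟨(hpos p hp).ne', hp⟩
    · exact (ae_restrict_mem (hT.prod hS)).mono fun p hp => (hpos p hp).le
    · exact (((hi (by fun_prop) (by fun_prop)).add (hi (by fun_prop) (by fun_prop))).sub
        (hi (by fun_prop) (by fun_prop))).sub (hi (by fun_prop) (by fun_prop))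
  linarith

/-! ### The largest break-even price of uninformed buyers -/

/-- The expected surplus of the buyers over the price `b` when they have no information. -/
noncomputable def expectedSurplus (v : ℝ → ℝ) (μ₀ : Measure Θ) (b : ℝ) : ℝ :=
  ∫ θ : Θ, tradeSurplus v θ b ∂μ₀

/-- A car already traded loses exactly the price increase. A newly traded one has `b < θ`, so `v θ -
c > θ - c > b - c`. Thus the surplus can jump only upwards as the price rises. -/
theorem sub_le_tradeSurplus (hgain : ∀ θ ∈ Θ, θ < v θ) (θ : Θ) {b c : ℝ} (hbc : b ≤ c) :
    tradeSurplus v θ b - (c - b) ≤ tradeSurplus v θ c := by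
  have := hgain θ θ.2
  unfold tradeSurplus
  split_ifs <;> linarith

/-- Only right-continuity can be expected: trade at `θ ≤ b` is a closed condition, so for each `θ`
whether there is trade does not change at prices slightly above `b`. -/
theorem tendsto_expectedSurplus {μ₀ : Measure Θ} [IsProbabilityMeasure μ₀]
    (hΘ : Θ ⊆ Set.Icc (0 : ℝ) 1) (hv : MonotoneOn v (insert (1 : ℝ) Θ))
    (hgain : ∀ θ ∈ Θ, θ < v θ) {b : ℝ} (hb : 0 ≤ b) :
    Tendsto (expectedSurplus v μ₀) (𝓝[>] b) (𝓝 (expectedSurplus v μ₀ b)) := by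
  have hlt : ∀ᶠ c in 𝓝[>] b, c < b + 1 := nhdsWithin_le_nhds (Iio_mem_nhds (by linarith))
  refine tendsto_integral_filter_of_dominated_convergence (fun _ => v 1 + (b + 1)) ?_ ?_
    (integrable_const _) (ae_of_all _ fun θ => ?_)
  · exact Eventually.of_forall fun c => (measurable_tradeSurplus (measurable_value hv)
      measurable_id measurable_const).aestronglyMeasurable
  · filter_upwards [hlt, self_mem_nhdsWithin] with c hc hc'
    rw [Set.mem_Ioi] at hc'
    refine ae_of_all _ fun θ => ?_
    have h := value_mem_Icc hΘ hv hgain θ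
    rw [Real.norm_eq_abs, abs_le]
    unfold tradeSurplus
    split_ifs <;> constructor <;> linarith [h.1, h.2]
  · by_cases h : (θ : ℝ) ≤ b
    · have e : (fun c => v θ - c) =ᶠ[𝓝[>] b] fun c => tradeSurplus v θ c := by
        filter_upwards [self_mem_nhdsWithin] with c hc
        rw [tradeSurplus, if_pos (h.trans (le_of_lt hc))]
      refine Tendsto.congr' e ?_
      rw [tradeSurplus, if_pos h]
      exact ((continuous_const.sub continuous_id).tendsto b).mono_left nhdsWithin_le_nhds
    · have e : (fun _ => (0 : ℝ)) =ᶠ[𝓝[>] b] fun c => tradeSurplus v θ c := by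
        filter_upwards [nhdsWithin_le_nhds (Iio_mem_nhds (not_le.1 h))] with c hc
        rw [tradeSurplus, if_neg (not_le.2 hc)]
      refine Tendsto.congr' e ?_
      rw [tradeSurplus, if_neg h]
      exact tendsto_const_nhds

/-- There is a largest price at which uninformed buyers do not lose, and they break even there. -/
theorem exists_greatest_price {μ₀ : Measure Θ} [IsProbabilityMeasure μ₀]
    (hΘ : Θ ⊆ Set.Icc (0 : ℝ) 1) (hv : MonotoneOn v (insert (1 : ℝ) Θ))
    (hgain : ∀ θ ∈ Θ, θ < v θ) (hv1 : 0 ≤ v 1) :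
    ∃ p ∈ Set.Icc 0 (v 1), expectedSurplus v μ₀ p = 0 ∧
      ∀ b ∈ Set.Icc 0 (v 1), 0 ≤ expectedSurplus v μ₀ b → b ≤ p := by
  set B : Set ℝ := {b | b ∈ Set.Icc 0 (v 1) ∧ 0 ≤ expectedSurplus v μ₀ b}
  have h0 : (0 : ℝ) ∈ B := by
    refine ⟨⟨le_rfl, hv1⟩, integral_nonneg fun θ => ?_⟩
    have := (value_mem_Icc hΘ hv hgain θ).1
    simp only [Pi.zero_apply, tradeSurplus]
    split_ifs <;> linarith
  have hbdd : BddAbove B := ⟨v 1, fun b hb => hb.1.2⟩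
  have hmax : ∀ b ∈ Set.Icc 0 (v 1), 0 ≤ expectedSurplus v μ₀ b → b ≤ sSup B :=
    fun b hb hb' => le_csSup hbdd ⟨hb, hb'⟩
  have hp : sSup B ∈ Set.Icc 0 (v 1) := ⟨le_csSup hbdd h0, csSup_le ⟨0, h0⟩ fun b hb => hb.1.2⟩
  refine ⟨sSup B, hp, le_antisymm ?_ ?_, hmax⟩
  · rcases hp.2.eq_or_lt with h | h
    -- At the price `v 1` no car is worth more than it costs.
    · refine integral_nonpos fun θ => ?_
      have := (value_mem_Icc hΘ hv hgain θ).2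
      simp only [Pi.zero_apply, tradeSurplus]
      split_ifs <;> linarith
    -- Prices between the supremum and `v 1` give negative surplus by maximality, and
    -- right-continuity passes this to the limit.
    · refine le_of_tendsto (tendsto_expectedSurplus hΘ hv hgain hp.1) ?_
      filter_upwards [self_mem_nhdsWithin, nhdsWithin_le_nhds (Iio_mem_nhds h)] with c hc hc'
      by_contra! hpos
      exact absurd (hmax c ⟨hp.1.trans (le_of_lt hc), le_of_lt hc'⟩ hpos.le) (not_le.2 hc)
  -- The supremum may be approached from below, where continuity can fail; the one-sided bound
  -- `sub_le_tradeSurplus` suffices.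
  · refine le_of_forall_pos_le_add fun ε hε => ?_
    obtain ⟨b, hb, hbp⟩ := exists_lt_of_lt_csSup ⟨0, h0⟩ (sub_lt_self (sSup B) hε)
    have hle := hmax b hb.1 hb.2
    have hi : ∀ {c : ℝ}, c ∈ Set.Icc 0 (v 1) → Integrable (fun θ : Θ => tradeSurplus v θ c) μ₀ :=
      fun hc => integrable_tradeSurplus hΘ hv hgain measurable_id measurable_const fun _ => hc
    have h : expectedSurplus v μ₀ b - (sSup B - b) ≤ expectedSurplus v μ₀ (sSup B) := by
      have h := integral_mono ((hi hb.1).sub (integrable_const (sSup B - b))) (hi hp)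
        fun θ => sub_le_tradeSurplus hgain θ hle
      simp only [Pi.sub_apply] at h
      rw [integral_sub (hi hb.1) (integrable_const _)] at h
      simpa [expectedSurplus] using h
    linarith [hb.2]

/-! ### Equilibrium without information -/

theorem integral_nullTest {μ₀ : Measure Θ} [IsProbabilityMeasure μ₀] (m₀ : M)
    {f : Θ × M → ℝ} (hf : Measurable f) :
    ∫ x, f x ∂(nullTest μ₀ m₀) = ∫ θ, f (θ, m₀) ∂μ₀ := by
  rw [nullTest, Measure.prod_dirac,
    integral_map measurable_prodMk_right.aemeasurable hf.aestronglyMeasurable]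

/-- The truthful ask is weakly dominant: it secures `max θ (max b₁ b₂)` pointwise, an upper bound
for every ask. -/
theorem sellerValue_le_of_ask_eq {lam : Measure (Θ × M)} [IsFiniteMeasure lam]
    (hΘ : Θ ⊆ Set.Icc (0 : ℝ) 1) {α : SellerStrategy Θ v M}
    (hα : ∀ (θ : Θ) (m : M), (α.1 (θ, m) : ℝ) = θ) (α' : SellerStrategy Θ v M)
    (β β' : BuyerStrategy v M) : sellerValue lam α' β β' ≤ sellerValue lam α β β' := by
  refine integral_mono (integrable_sellerPayoff hΘ _ _ _) (integrable_sellerPayoff hΘ _ _ _)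
    fun x => ?_
  dsimp only
  rw [hα x.1 x.2, sellerPayoff_self]
  exact sellerPayoff_le _ _ _ _

/-- Without information both buyers may bid the largest price at which they do not lose. -/
theorem exists_isWDIC_nullTest {μ₀ : Measure Θ} [IsProbabilityMeasure μ₀] (m₀ : M)
    (hΘ : Θ ⊆ Set.Icc (0 : ℝ) 1) (hv : MonotoneOn v (insert (1 : ℝ) Θ))
    (hgain : ∀ θ ∈ Θ, θ < v θ) {p : ℝ} (hp : p ∈ Set.Icc 0 (v 1))
    (hzero : expectedSurplus v μ₀ p = 0)
    (hmax : ∀ b ∈ Set.Icc 0 (v 1), 0 ≤ expectedSurplus v μ₀ b → b ≤ p) :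
    ∃ σ : StrategyProfile Θ v M, IsWDIC (nullTest μ₀ m₀) σ ∧ ∀ m, topBid σ m = p := by
  let α : SellerStrategy Θ v M :=
    ⟨fun x => ⟨x.1, (hΘ x.1.2).1, (hgain x.1 x.1.2).le.trans (value_mem_Icc hΘ hv hgain x.1).2⟩,
      measurable_fst.subtype_val.subtype_mk⟩
  let β : BuyerStrategy v M := ⟨fun _ => ⟨p, hp⟩, measurable_const⟩
  have : IsProbabilityMeasure (nullTest μ₀ m₀) := by unfold nullTest; infer_instance
  have hval : ∀ γ : BuyerStrategy v M, buyerValue (nullTest μ₀ m₀) α γ β =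
      ∫ θ : Θ, buyerPayoff v θ θ (γ.1 m₀) p ∂μ₀ := fun γ => by
    unfold buyerValue
    rw [integral_nullTest m₀ (measurable_buyerPayoff hv α γ β)]
  have hβ : buyerValue (nullTest μ₀ m₀) α β β = 0 := by
    rw [hval]
    calc ∫ θ : Θ, buyerPayoff v θ θ p p ∂μ₀ = ∫ θ : Θ, (1 / 2) * tradeSurplus v θ p ∂μ₀ := by
          congr 1 with θ
          simp [buyerPayoff, tradeSurplus]
      _ = 0 := by rw [integral_const_mul, ← expectedSurplus, hzero, mul_zero]
  have hdev : ∀ γ : BuyerStrategy v M, buyerValue (nullTest μ₀ m₀) α γ β ≤ 0 := fun γ => by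
    -- A lower bid never wins, an equal bid earns half of zero, and a higher bid earns the whole
    -- surplus at a price above `p`, which is negative by maximality.
    rcases lt_trichotomy (γ.1 m₀ : ℝ) p with h | h | h
    · rw [hval]
      refine (integral_eq_zero_of_ae (ae_of_all _ fun θ => ?_)).le
      simp [buyerPayoff, h.not_gt, h.ne]
    · rw [hval, h, ← hβ, hval]
    · rw [hval]
      have : ∫ θ : Θ, buyerPayoff v θ θ (γ.1 m₀) p ∂μ₀ = expectedSurplus v μ₀ (γ.1 m₀) := by
        unfold expectedSurplus
        congr 1 with θ
        simp [buyerPayoff, tradeSurplus, h, h.ne']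
      rw [this]
      by_contra! hpos
      exact absurd (hmax _ (γ.1 m₀).2 hpos.le) (not_le.2 h)
  refine ⟨⟨α, β, β⟩, ⟨⟨fun α' => ?_, fun γ => ?_, fun γ => ?_⟩, fun θ m => rfl⟩,
    fun m => max_self p⟩
  · exact sellerValue_le_of_ask_eq hΘ (fun _ _ => rfl) _ _ _
  · exact (hdev γ).trans hβ.ge
  · exact (hdev γ).trans hβ.ge

theorem bddAbove_noInfoPayoffs {μ₀ : Measure Θ} [IsProbabilityMeasure μ₀] (m₀ : M)
    (hΘ : Θ ⊆ Set.Icc (0 : ℝ) 1) : BddAbove (noInfoPayoffs v μ₀ m₀) := by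
  refine ⟨max 1 (v 1), ?_⟩
  rintro r ⟨σ, hσ, rfl⟩
  have : IsProbabilityMeasure (nullTest μ₀ m₀) := by unfold nullTest; infer_instance
  rw [sellerProfit_eq hσ.2]
  calc ∫ x : Θ × M, max (x.1 : ℝ) (topBid σ x.2) ∂(nullTest μ₀ m₀)
      ≤ ∫ _ : Θ × M, max 1 (v 1) ∂(nullTest μ₀ m₀) :=
        integral_mono (integrable_max hΘ measurable_fst
          ((measurable_topBid σ).comp measurable_snd) fun x => topBid_mem_Icc σ x.2)
          (integrable_const _)
          fun x => max_le_max (hΘ x.1.2).2 (topBid_mem_Icc σ x.2).2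
    _ = max 1 (v 1) := by simp

/-! ### Comparison of a credible profile with no information -/

theorem integral_fst_of_isTest {μ₀ : Measure Θ} {lam : Measure (Θ × M)} (hlam : IsTest μ₀ lam)
    {f : Θ → ℝ} (hf : Measurable f) : ∫ x, f x.1 ∂lam = ∫ θ, f θ ∂μ₀ := by
  rw [← hlam.2, Measure.fst, integral_map measurable_fst.aemeasurable hf.aestronglyMeasurable]

theorem expectedSurplus_eq_integral {μ₀ : Measure Θ} {lam : Measure (Θ × M)}
    (hlam : IsTest μ₀ lam) (hv : MonotoneOn v (insert (1 : ℝ) Θ)) (b : ℝ) :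
    expectedSurplus v μ₀ b = ∫ x : Θ × M, tradeSurplus v x.1 b ∂lam :=
  (integral_fst_of_isTest hlam (f := fun θ => tradeSurplus v θ b)
    (measurable_tradeSurplus (measurable_value hv) measurable_id measurable_const)).symm

/-- Under a credible WD-IC profile only cars worth at most the largest price at which uninformed
buyers do not lose are traded. -/
theorem ae_le_of_isCredible {μ₀ : Measure Θ} {lam : Measure (Θ × M)}
    (hΘ : Θ ⊆ Set.Icc (0 : ℝ) 1) (hv : MonotoneOn v (insert (1 : ℝ) Θ))
    (hgain : ∀ θ ∈ Θ, θ < v θ) {p : ℝ} (hp : p ∈ Set.Icc 0 (v 1))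
    (hmax : ∀ b ∈ Set.Icc 0 (v 1), 0 ≤ expectedSurplus v μ₀ b → b ≤ p)
    {σ : StrategyProfile Θ v M} (hlam : IsTest μ₀ lam) (hcred : IsCredible μ₀ lam σ)
    (hσ : IsWDIC lam σ) :
    ∀ᵐ x ∂lam, (x.1 : ℝ) ≤ topBid σ x.2 → (x.1 : ℝ) ≤ p := by
  have := hlam.1
  set T : ℝ → Set (Θ × M) := fun t => {x | t < (x.1 : ℝ) ∧ (x.1 : ℝ) ≤ topBid σ x.2} with hT
  have hanti : Antitone T := fun s t hst x hx => ⟨hst.trans_lt hx.1, hx.2⟩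
  suffices h : lam (T p) = 0 by
    filter_upwards [measure_eq_zero_iff_ae_notMem.1 h] with x hx hx'
    by_contra! hlt
    exact hx ⟨hlt, hx'⟩
  by_contra hpne
  have hle1 : ∀ t, lam (T t) ≠ 0 → t ≤ 1 := fun t ht => by
    obtain ⟨x, hx⟩ := nonempty_of_measure_ne_zero ht
    exact hx.1.le.trans (hΘ x.1.2).2
  have hbdd : BddAbove {t | lam (T t) ≠ 0} := ⟨1, hle1⟩
  have hne : {t | lam (T t) ≠ 0}.Nonempty := ⟨p, hpne⟩
  -- `c` is the essential supremum of the traded qualities. The sequences `u` and `w` reduce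
  -- almost-sure statements at `c` to countably many thresholds below and above it.
  set c := sSup {t | lam (T t) ≠ 0} with hc
  have hpc : p ≤ c := le_csSup hbdd hpne
  obtain ⟨u, -, hu, hulim⟩ := exists_seq_strictMono_tendsto c
  obtain ⟨w, -, hw, hwlim⟩ := exists_seq_strictAnti_tendsto c
  have hTlt : ∀ t < c, lam (T t) ≠ 0 := fun t ht => by
    obtain ⟨s, hs, hts⟩ := exists_lt_of_lt_csSup hne ht
    exact fun h0 => hs (measure_mono_null (hanti hts.le) h0)
  have hcv : c ≤ v 1 := by
    refine le_of_forall_lt fun t ht => ?_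
    obtain ⟨x, hx⟩ := nonempty_of_measure_ne_zero (hTlt t ht)
    exact hx.1.trans_le (hx.2.trans (topBid_mem_Icc σ x.2).2)
  have hTc : ∀ᵐ x ∂lam, (x.1 : ℝ) ≤ topBid σ x.2 → (x.1 : ℝ) ≤ c := by
    have hn : ∀ n, ∀ᵐ x ∂lam, x ∉ T (w n) := fun n => by
      rw [← measure_eq_zero_iff_ae_notMem]
      by_contra h
      exact absurd (le_csSup hbdd h) (not_le.2 (hw n))
    filter_upwards [ae_all_iff.2 hn] with x hx hx'
    refine ge_of_tendsto' hwlim fun n => ?_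
    by_contra! hlt
    exact hx n ⟨hlt, hx'⟩
  have hSc : ∀ᵐ x ∂lam, topBid σ x.2 < c → c ≤ (x.1 : ℝ) := by
    have hn : ∀ n, ∀ᵐ x ∂lam, ¬((x.1 : ℝ) ≤ u n ∧ topBid σ x.2 ≤ u n) := fun n =>
      measure_eq_zero_iff_ae_notMem.1
        (measure_eq_zero_of_isCredible hΘ hlam hcred hσ.2 (hTlt _ (hu n)))
    filter_upwards [ae_all_iff.2 hn] with x hx hx'
    refine le_of_tendsto hulim ?_
    filter_upwards [hulim.eventually (Ioi_mem_nhds hx')] with n hn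
    by_contra! hlt
    exact hx n ⟨hlt.le, le_of_lt hn⟩
  -- The comparison is pointwise: on bids at least `c`, by `hTc` the same cars are traded at price
  -- `c`, only cheaper; on lower bids, by `hSc`, a car traded at `c` has `v θ > θ ≥ c`.
  have hF : 0 ≤ expectedSurplus v μ₀ c := by
    have hc' : c ∈ Set.Icc 0 (v 1) := ⟨hp.1.trans hpc, hcv⟩
    have hA : MeasurableSet {m | c ≤ topBid σ m} :=
      measurableSet_le measurable_const (measurable_topBid σ)
    refine (setIntegral_tradeSurplus_nonneg hΘ hv hgain (hp.1.trans hp.2) hσ hA).trans ?_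
    rw [expectedSurplus_eq_integral hlam hv, ← integral_indicator (measurable_snd hA)]
    refine integral_mono_ae ((integrable_tradeSurplus hΘ hv hgain measurable_fst
      ((measurable_topBid σ).comp measurable_snd) fun x => topBid_mem_Icc σ x.2).indicator
        (measurable_snd hA))
      (integrable_tradeSurplus hΘ hv hgain measurable_fst measurable_const fun _ => hc') ?_
    filter_upwards [hTc, hSc] with x h₁ h₂
    have hx := hgain x.1 x.1.2
    by_cases hcb : c ≤ topBid σ x.2
    · rw [Set.indicator_of_mem (by exact hcb)]
      dsimp only [tradeSurplus]
      split_ifs with h₃ h₄ h₄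
      · linarith
      · exact absurd (h₁ h₃) h₄
      · exact absurd (h₄.trans hcb) h₃
      · exact le_rfl
    · rw [Set.indicator_of_notMem (by exact hcb)]
      have := h₂ (not_le.1 hcb)
      dsimp only [tradeSurplus]
      split_ifs <;> linarith
  have hcp : c = p := le_antisymm (hmax c ⟨hp.1.trans hpc, hcv⟩ hF) hpc
  apply hpne
  rw [← hcp, measure_eq_zero_iff_ae_notMem]
  filter_upwards [hTc] with x hx hx'
  exact absurd (hx hx'.2) (not_le.2 hx'.1)

/-- The seller's payoff when, without information, both buyers bid the largest price at which they
do not lose is at least her payoff in every credible WD-IC profile. -/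
theorem sellerProfit_le_integral_max {μ₀ : Measure Θ} {lam : Measure (Θ × M)}
    (hΘ : Θ ⊆ Set.Icc (0 : ℝ) 1) (hv : MonotoneOn v (insert (1 : ℝ) Θ))
    (hgain : ∀ θ ∈ Θ, θ < v θ) {p : ℝ} (hp : p ∈ Set.Icc 0 (v 1))
    (hzero : expectedSurplus v μ₀ p = 0)
    (hmax : ∀ b ∈ Set.Icc 0 (v 1), 0 ≤ expectedSurplus v μ₀ b → b ≤ p)
    {σ : StrategyProfile Θ v M} (hlam : IsTest μ₀ lam) (hcred : IsCredible μ₀ lam σ)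
    (hσ : IsWDIC lam σ) :
    sellerProfit lam σ ≤ ∫ θ : Θ, max (θ : ℝ) p ∂μ₀ := by
  have := hlam.1
  have hb : Measurable fun x : Θ × M => topBid σ x.2 := (measurable_topBid σ).comp measurable_snd
  have hI₁ := integrable_max (μ := lam) hΘ measurable_fst hb fun x => topBid_mem_Icc σ x.2
  have hI₂ := integrable_tradeSurplus (μ := lam) hΘ hv hgain measurable_fst hb
    fun x => topBid_mem_Icc σ x.2
  have hI₃ := integrable_max (μ := lam) hΘ measurable_fst measurable_const
    fun _ : Θ × M => hp
  have hI₄ := integrable_tradeSurplus (μ := lam) hΘ hv hgain measurable_fst measurable_const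
    fun _ : Θ × M => hp
  have hsurplus := setIntegral_tradeSurplus_nonneg hΘ hv hgain (hp.1.trans hp.2) hσ
    MeasurableSet.univ
  rw [Set.preimage_univ, setIntegral_univ] at hsurplus
  rw [expectedSurplus_eq_integral hlam hv] at hzero
  rw [sellerProfit_eq hσ.2, ← integral_fst_of_isTest hlam
    (f := fun θ => max (θ : ℝ) p) (measurable_subtype_coe.max measurable_const)]
  -- Both integrands are welfare, in which the price cancels; every car traded under the profile is
  -- also traded at `p`, and each trade adds `v θ - θ > 0`.
  have hkey : ∫ x : Θ × M, (max (x.1 : ℝ) (topBid σ x.2) + tradeSurplus v x.1 (topBid σ x.2)) ∂lam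
      ≤ ∫ x : Θ × M, (max (x.1 : ℝ) p + tradeSurplus v x.1 p) ∂lam := by
    refine integral_mono_ae (hI₁.add hI₂) (hI₃.add hI₄) ?_
    filter_upwards [ae_le_of_isCredible hΘ hv hgain hp hmax hlam hcred hσ] with x hx
    have := hgain x.1 x.1.2
    simp only [max_eq_add_ite, tradeSurplus]
    split_ifs with h₁ h₂ h₂
    · linarith
    · exact absurd (hx h₁) h₂
    · linarith
    · exact le_rfl
  rw [integral_add hI₁ hI₂, integral_add hI₃ hI₄] at hkey
  linarith

end

end Lemons

/-! ### The main result -/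

theorem proposition4
    (Θ : Set ℝ) [PolishSpace Θ] (hΘ : Θ ⊆ Set.Icc (0 : ℝ) 1)
    (v : ℝ → ℝ) (hv : MonotoneOn v (insert (1 : ℝ) Θ)) (hgain : ∀ θ ∈ Θ, θ < v θ)
    (μ₀ : Measure Θ) [IsProbabilityMeasure μ₀] (hmean : ∫ θ : Θ, v θ ∂μ₀ < 1)
    (M : Type*) [TopologicalSpace M] [PolishSpace M] [MeasurableSpace M] [BorelSpace M]
    (m₀ : M) :
    IsLUB (Lemons.noInfoPayoffs v μ₀ m₀) (Lemons.R₀ v μ₀ m₀) ∧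
    ∀ (lam : Measure (Θ × M)) (σ : Lemons.StrategyProfile Θ v M),
      Lemons.IsTest μ₀ lam → Lemons.IsCredible μ₀ lam σ → Lemons.IsWDIC lam σ →
        Lemons.sellerProfit lam σ ≤ Lemons.R₀ v μ₀ m₀ := by
  obtain ⟨θ₀⟩ : Nonempty Θ := nonempty_of_isProbabilityMeasure μ₀
  have hv1 : 0 ≤ v 1 :=
    (Lemons.value_mem_Icc hΘ hv hgain θ₀).1.trans (Lemons.value_mem_Icc hΘ hv hgain θ₀).2
  obtain ⟨p, hp, hzero, hmax⟩ := Lemons.exists_greatest_price (μ₀ := μ₀) hΘ hv hgain hv1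
  obtain ⟨σ₀, hσ₀, htop⟩ := Lemons.exists_isWDIC_nullTest m₀ hΘ hv hgain hp hzero hmax
  have hbdd := Lemons.bddAbove_noInfoPayoffs (v := v) (μ₀ := μ₀) m₀ hΘ
  have hmem : Lemons.sellerProfit (Lemons.nullTest μ₀ m₀) σ₀ ∈ Lemons.noInfoPayoffs v μ₀ m₀ :=
    ⟨σ₀, hσ₀, rfl⟩
  refine ⟨isLUB_csSup ⟨_, hmem⟩ hbdd, fun lam σ hlam hcred hσ => ?_⟩
  refine (Lemons.sellerProfit_le_integral_max hΘ hv hgain hp hzero hmax hlam hcred hσ).trans ?_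
  refine le_trans (le_of_eq ?_) (le_csSup hbdd hmem)
  rw [Lemons.sellerProfit_eq hσ₀.2]
  simp only [htop]
  rw [Lemons.integral_nullTest m₀ (measurable_fst.subtype_val.max measurable_const)]
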